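/- Conventions. Let $\mu$ be a regular (infinite) cardinal. A poset is $\mu$-directed if each of its subsets of cardinality $<\mu$ has an upper bound. For cardinals $\theta,\mu$ put $\theta^{<\mu}=\sup_{\alpha<\mu}\theta^{\alpha}$ ($\alpha$ ranging over cardinals); a cardinal $\lambda$ is $\mu$-closed if $\theta^{<\mu}<\lambda$ for all $\theta<\lambda$. A $\mu$-ary vocabulary is a set $\tau$ of function and relation symbols, all of arity $<\mu$. An abstract class is a pair $\mathbf K=(K,\le_{\mathbf K})$, where $K$ is a class of structures in a fixed $\mu$-ary vocabulary $\tau$ and $\le_{\mathbf K}$ is a partial order on $K$, both closed under isomorphism, such that $M\le_{\mathbf K}N$ implies that $M$ is a substructure of $N$. Write $UM$ for the universe of $M$. $\mathbf K$ is a $\mu$-AEC if: (1) if $M_0\subseteq M_1\le_{\mathbf K}M_2$ and $M_0\le_{\mathbf K}M_2$, with all three in $K$, then $M_0\le_{\mathbf K}M_1$; (2) if $\langle M_i: i\in I\rangle$ is a system in $\mathbf K$ indexed by a $\mu$-directed poset, with $M_i\le_{\mathbf K}M_j$ for $i\le j$, then $M=\bigcup_i M_i\in K$, $M_i\le_{\mathbf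 K}M$ for all $i$, and $M\le_{\mathbf K}N$ whenever $M_i\le_{\mathbf K}N$ for all $i$; (3) there is a cardinal $\kappa=\kappa^{<\mu}\ge|\tau|+\mu$ such that for all $M\in K$ and $A\subseteq UM$ there is $M_0\le_{\mathbf K}M$ with $A\subseteq UM_0$ and $|UM_0|\le|A|^{<\mu}+\kappa$. The least such $\kappa$ is denoted $\mathrm{LS}(\mathbf K)$. $\mathbf K$ is regarded as a category whose morphisms $M\to N$ are the maps $f$ that are isomorphisms of $M$ onto a substructure $f[M]$ with $f[M]\le_{\mathbf K}N$. In a category, an object $M$ is $\theta$-presentable ($\theta$ regular) if $\mathrm{Hom}(M,-)$ preserves $\theta$-directed colimits; it is $(<\lambda)$-presentable if it is $\theta$-presentable for some regular $\theta<\lambda+\aleph_1$; its presentability rank is the least regular $\theta$ for which it is $\theta$-presentable. For $\nu$ regular, a $(\nu,<\lambda)$-system is a diagram of $(<\lambda)$-presentable objects indexed by a $\nu$-directed poset; such a system with colimit $(d_i:M_i\to M)_{i\in I}$ is proper if the identity of $M$ does not factor through any of the $d_i$. For $\theta$ regular, a category is $\theta$-accessible if it has $\theta$-directed colimits, has only a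 set of $\theta$-presentable objects up to isomorphism, and every object is a $\theta$-directed colimit of $\theta$-presentable objects. Theorem. Let $\mathbf K$ be a $\mu$-AEC and let $\lambda>\mathrm{LS}(\mathbf K)$ be a $\mu$-closed cardinal. Then: (a) there are no proper $(\lambda^+,<\lambda^+)$-systems in $\mathbf K$; (b) if moreover $\mathbf K$ is $\lambda^+$-accessible and has an object $M$ with $|UM|\ge\lambda$, then $\mathbf K$ has an object of presentability rank $\lambda^+$. -/

import Mathlib

open CategoryTheory CategoryTheory.Limits Cardinal

universe w v u

/-- A (possibly infinitary) vocabulary: a set of function symbols and a set of relation symbols,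
each with an arity, which is an arbitrary set. -/
structure Vocabulary : Type (w + 1) where
  Fun : Type w
  Rel : Type w
  funArity : Fun → Type w
  relArity : Rel → Type w

namespace Vocabulary

/-- All arities are strictly smaller than `μ`. -/
def IsAry (τ : Vocabulary.{w}) (μ : Cardinal.{w}) : Prop :=
  (∀ f, #(τ.funArity f) < μ) ∧ ∀ r, #(τ.relArity r) < μ

/-- The number of symbols. -/
noncomputable def card (τ : Vocabulary.{w}) : Cardinal.{w} := #τ.Fun + #τ.Rel

/-- A `τ`-structure. -/
structure Str (τ : Vocabulary.{w}) : Type (w + 1) where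
  carrier : Type w
  funMap : ∀ f : τ.Fun, (τ.funArity f → carrier) → carrier
  relMap : ∀ r : τ.Rel, (τ.relArity r → carrier) → Prop

variable {τ : Vocabulary.{w}}

/-- A substructure of `M`, given by its universe: a subset closed under the functions. -/
@[ext]
structure Substr (M : τ.Str) : Type w where
  carrier : Set M.carrier
  closed : ∀ (f : τ.Fun) (a : τ.funArity f → M.carrier),
    (∀ i, a i ∈ carrier) → M.funMap f a ∈ carrier

namespace Substr

variable {M : τ.Str}

/-- The `τ`-structure induced on a substructure. -/
def toStr (S : Substr M) : τ.Str where
  carrier := S.carrier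
  funMap f a := ⟨M.funMap f fun i => (a i).1, S.closed f _ fun i => (a i).2⟩
  relMap r a := M.relMap r fun i => (a i).1

/-- `M` as a substructure of itself. -/
def whole (M : τ.Str) : Substr M where
  carrier := Set.univ
  closed _ _ _ := Set.mem_univ _

/-- `S ∩ T` as a substructure of `T`; it is used for `S ⊆ T`, when it is `S` itself. -/
def within (S T : Substr M) : Substr T.toStr where
  carrier := {x : T.carrier | x.1 ∈ S.carrier}
  closed f _ ha := S.closed f _ ha

end Substr

/-- An embedding of `τ`-structures: a map which is an isomorphism onto its image. -/
@[ext]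
structure Emb (M N : τ.Str) : Type w where
  toFun : M.carrier → N.carrier
  injective : Function.Injective toFun
  map_fun : ∀ (f : τ.Fun) (a : τ.funArity f → M.carrier),
    toFun (M.funMap f a) = N.funMap f fun i => toFun (a i)
  map_rel : ∀ (r : τ.Rel) (a : τ.relArity r → M.carrier),
    M.relMap r a ↔ N.relMap r fun i => toFun (a i)

namespace Emb

variable {M N P : τ.Str}

/-- The identity embedding. -/
def id (M : τ.Str) : Emb M M where
  toFun x := x
  injective _ _ h := h
  map_fun _ _ := rfl
  map_rel _ _ := Iff.rfl

/-- The composite of `f : M → N` and `g : N → P`. -/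
def comp (f : Emb M N) (g : Emb N P) : Emb M P where
  toFun x := g.toFun (f.toFun x)
  injective _ _ h := f.injective (g.injective h)
  map_fun s a := by rw [f.map_fun, g.map_fun]
  map_rel r a := (f.map_rel r a).trans (g.map_rel r _)

/-- The image of an embedding. -/
def range (f : Emb M N) : Substr N where
  carrier := Set.range f.toFun
  closed s a ha := by
    choose b hb using ha
    exact ⟨M.funMap s b, by rw [f.map_fun]; exact congrArg _ (funext hb)⟩

/-- An embedding, with values in its image. -/
def toRange (f : Emb M N) : Emb M f.range.toStr where
  toFun x := ⟨f.toFun x, x, rfl⟩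
  injective _ _ h := f.injective (congrArg Subtype.val h)
  map_fun s a := Subtype.ext (f.map_fun s a)
  map_rel r a := f.map_rel r a

end Emb

end Vocabulary

open Vocabulary

/-- An abstract class of `τ`-structures. Since `M ≤ N` implies that `M` is a substructure of `N`,
the ordering `≤` is given by the relation `le N S`, which says that the structure `N`
is in the class and that the substructure `S` of `N` is in the class and satisfies `S ≤ N`.
Antisymmetry is automatic. -/
structure AbstractClass (τ : Vocabulary.{w}) where
  mem : τ.Str → Prop
  le : ∀ N : τ.Str, Substr N → Prop
  mem_of_le : ∀ (N : τ.Str) (S : Substr N), le N S → mem N ∧ mem S.toStr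
  le_refl : ∀ N : τ.Str, mem N → le N (Substr.whole N)
  le_trans : ∀ (N : τ.Str) (S T : Substr N), S.carrier ⊆ T.carrier →
    le T.toStr (S.within T) → le N T → le N S
  mem_iso : ∀ (N N' : τ.Str) (e : Emb N N'), Function.Surjective e.toFun → mem N → mem N'
  le_iso : ∀ (N N' : τ.Str) (e : Emb N N'), Function.Surjective e.toFun →
    ∀ (S : Substr N) (S' : Substr N'), (∀ x, x ∈ S.carrier ↔ e.toFun x ∈ S'.carrier) →
      le N S → le N' S'

/-- A poset is `μ`-directed if every subset with fewer than `μ` elements has an upper bound. -/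
def IsMuDirected (μ : Cardinal.{w}) (I : Type w) [PartialOrder I] : Prop :=
  ∀ s : Set I, #s < μ → BddAbove s

namespace AbstractClass

variable {τ : Vocabulary.{w}} (K : AbstractClass τ)

/-- `S ≤ T`, for two substructures `S`, `T` of a common structure
(which need not be in the class). -/
def LeIn {M : τ.Str} (S T : Substr M) : Prop :=
  S.carrier ⊆ T.carrier ∧ K.le T.toStr (S.within T)

/-- `S` is a `μ`-directed system in `K`, all of whose members are substructures of the
structure `M` (which need not be in the class). -/
def IsDirectedSystem (μ : Cardinal.{w}) {M : τ.Str} {I : Type w} [PartialOrder I]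
    (S : I → Substr M) : Prop :=
  IsMuDirected μ I ∧ (∀ i, K.mem (S i).toStr) ∧ ∀ i j, i ≤ j → K.LeIn (S i) (S j)

/-- The instance of the Löwenheim-Skolem-Tarski axiom at the cardinal `κ`. -/
def LST (μ κ : Cardinal.{w}) : Prop :=
  κ = κ ^< μ ∧ τ.card + μ ≤ κ ∧
    ∀ M : τ.Str, K.mem M → ∀ A : Set M.carrier,
      ∃ S : Substr M, K.le M S ∧ A ⊆ S.carrier ∧ #S.carrier ≤ #A ^< μ + κ

/-- `K` is a `μ`-abstract elementary class. -/
structure IsMuAEC (μ : Cardinal.{w}) : Prop where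
  regular : μ.IsRegular
  ary : τ.IsAry μ
  coherence : ∀ (N : τ.Str) (S T : Substr N), S.carrier ⊆ T.carrier →
    K.le N S → K.le N T → K.le T.toStr (S.within T)
  /-- The union `M` of a `μ`-directed system is in `K`, and is above every member. -/
  chain_mem : ∀ (M : τ.Str) (I : Type w) [PartialOrder I] (S : I → Substr M),
    K.IsDirectedSystem μ S → (∀ x, ∃ i, x ∈ (S i).carrier) → K.mem M ∧ ∀ i, K.le M (S i)
  /-- If all members of a `μ`-directed system are below `N`, so is their union `U`. -/
  chain_le : ∀ (N : τ.Str) (I : Type w) [PartialOrder I] (S : I → Substr N),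
    K.IsDirectedSystem μ S → (∀ i, K.le N (S i)) →
      ∀ U : Substr N, (∀ x, x ∈ U.carrier ↔ ∃ i, x ∈ (S i).carrier) → K.le N U
  lst : ∃ κ, K.LST μ κ

/-- The Löwenheim-Skolem-Tarski number of a `μ`-abstract elementary class. -/
noncomputable def LS (μ : Cardinal.{w}) : Cardinal.{w} := sInf {κ | K.LST μ κ}

/-- The objects of the category associated with `K`. -/
structure Obj : Type (w + 1) where
  str : τ.Str
  mem : K.mem str

/-- The morphisms `M ⟶ N` of the category associated with `K`: the embeddings `f` with
`f[M] ≤ N`. -/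
@[ext]
structure Hom (M N : K.Obj) : Type w where
  emb : Emb M.str N.str
  range_le : K.le N.str emb.range

instance : Category.{w} K.Obj where
  Hom M N := K.Hom M N
  id M := ⟨Emb.id M.str, by
    have h : (Emb.id M.str).range = Substr.whole M.str := by
      ext x
      simp [Emb.range, Emb.id, Substr.whole]
    rw [h]
    exact K.le_refl _ M.mem⟩
  comp {M N P} f g := ⟨f.emb.comp g.emb, by
    refine K.le_trans P.str _ g.emb.range ?_ ?_ g.range_le
    · rintro _ ⟨x, rfl⟩
      exact ⟨f.emb.toFun x, rfl⟩
    · refine K.le_iso N.str _ g.emb.toRange ?_ f.emb.range _ ?_ f.range_le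
      · rintro ⟨_, x, rfl⟩
        exact ⟨x, rfl⟩
      · intro x
        constructor
        · rintro ⟨y, rfl⟩
          exact ⟨y, rfl⟩
        · rintro ⟨y, hy⟩
          exact ⟨y, g.emb.injective hy⟩⟩

end AbstractClass

/-- `κ` is `μ`-closed if `θ ^ (<μ) < κ` for all `θ < κ`. -/
def IsMuClosed (μ κ : Cardinal.{w}) : Prop := ∀ θ < κ, θ ^< μ < κ

section Presentability

variable {C : Type u} [Category.{v} C]

/-- `κ` is a regular cardinal and `X` is `κ`-presentable. -/
def IsPresentableAt (X : C) (κ : Cardinal.{w}) : Prop :=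
  ∃ _ : Fact κ.IsRegular, IsCardinalPresentable X κ

/-- `X` is `(<κ)`-presentable. -/
def IsLTPresentable (X : C) (κ : Cardinal.{w}) : Prop :=
  ∃ θ : Cardinal.{w}, θ < κ + ℵ_ 1 ∧ IsPresentableAt X θ

/-- The presentability rank of `X` is `κ`. -/
def HasPresentabilityRank (X : C) (κ : Cardinal.{w}) : Prop :=
  IsLeast {θ | IsPresentableAt X θ} κ

/-- `D` is a `(μ, <κ)`-system. -/
def IsSystem (μ κ : Cardinal.{w}) {I : Type w} [PartialOrder I] (D : I ⥤ C) : Prop :=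
  IsMuDirected μ I ∧ ∀ i, IsLTPresentable (D.obj i) κ

/-- A system with colimit `c` is proper if the identity of the colimit
does not factor through any object in the system. -/
def IsProper {I : Type w} [PartialOrder I] {D : I ⥤ C} (c : Cocone D) : Prop :=
  ∀ i, ¬ ∃ g : c.pt ⟶ D.obj i, g ≫ c.ι.app i = 𝟙 c.pt

variable (C) in
/-- `κ` is a regular cardinal and `C` is a `κ`-accessible category. -/
def IsAccessibleAt (κ : Cardinal.{w}) : Prop :=
  ∃ _ : Fact κ.IsRegular, IsCardinalAccessibleCategory C κ

end Presentability

/-!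
Morphisms of `K` are injective and unions of `μ`-directed systems inside a given object are again
`≤` it, so for regular `ν ≥ μ` a cocone over a `ν`-filtered diagram is a colimit if and only if its
legs are jointly surjective. Two consequences drive the proof. First, if `θ ≥ μ` is regular and the
Löwenheim–Skolem property holds below `θ`, each object `M` is the `θ`-directed colimit of the
`S ≤ M` of size `< θ`; if `M` is `θ`-presentable, its identity factors through such an `S`, whence
`|UM| < θ`. A `μ`-closed `κ > LS(K)` has such a `θ ≤ κ` above every regular cardinal `≤ κ`: take
`κ` itself if it is regular, and otherwise a successor `(x ^ (<μ))⁺ < κ`. So presentability at a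
regular cardinal `≤ κ` forces size `< κ`. Second, `κ` elements of a `ν`-filtered colimit with
`κ < ν` already come from a single object of the diagram, so if all objects are smaller than `κ`,
some leg is bijective.
-/

theorem le_powerlt_self {μ : Cardinal.{w}} (x : Cardinal.{w}) (hμ : 1 < μ) : x ≤ x ^< μ := by
  simpa only [power_one] using le_powerlt x hμ

theorem powerlt_le_powerlt_right {x y : Cardinal.{w}} (μ : Cardinal.{w}) (h : x ≤ y) :
    x ^< μ ≤ y ^< μ :=
  powerlt_le.2 fun _ hc => (power_le_power_right h).trans (le_powerlt y hc)

theorem prod_sum_eq_sum_prod {B : Type w} {I : B → Type w} (f : ∀ b, I b → Cardinal.{w}) :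
    (Cardinal.prod fun b => Cardinal.sum (f b)) =
      Cardinal.sum fun t : ∀ b, I b => Cardinal.prod fun b => f b (t b) := by
  let e : (∀ b, Σ i, (f b i).out) ≃ Σ t : ∀ b, I b, ∀ b, (f b (t b)).out :=
    { toFun := fun g => ⟨fun b => (g b).1, fun b => (g b).2⟩
      invFun := fun p b => ⟨p.1 b, p.2 b⟩
      left_inv := fun _ => rfl
      right_inv := fun _ => rfl }
  simpa only [mk_sigma, mk_pi, mk_out] using mk_congr e

theorem exists_mk_Iio_toType_eq {c μ : Cardinal.{w}} (h : c < μ) :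
    ∃ i : μ.ord.ToType, #(Set.Iio i) = c := by
  obtain ⟨i, hi⟩ := Ordinal.typein_surj (α := μ.ord.ToType) (· < ·) (o := c.ord) (by simpa)
  exact ⟨i, (congrArg Ordinal.card hi).trans (card_ord c)⟩

theorem powerlt_le_sum_mk_Iio (x μ : Cardinal.{w}) :
    x ^< μ ≤ Cardinal.sum fun i : μ.ord.ToType => x ^ #(Set.Iio i) := by
  refine powerlt_le.2 fun c hc => ?_
  obtain ⟨i, rfl⟩ := exists_mk_Iio_toType_eq hc
  exact le_sum (fun i : μ.ord.ToType => x ^ #(Set.Iio i)) i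

theorem power_powerlt_le {x μ b : Cardinal.{w}} (hμ : μ.IsRegular) (hx : μ ≤ x) (hb : b < μ) :
    (x ^< μ) ^ b ≤ x ^< μ := by
  induction b using Cardinal.inductionOn with | _ B
  have hx_le : x ≤ x ^< μ := le_powerlt_self x (one_lt_aleph0.trans_le hμ.aleph0_le)
  have prod_le : ∀ t : B → μ.ord.ToType,
      (Cardinal.prod fun b => x ^ #(Set.Iio (t b))) ≤ x ^< μ := by
    intro t
    rw [← power_sum]
    exact le_powerlt x (sum_lt_of_isRegular hμ hb fun b => by simpa using mk_Iio_lt (t b) (by simp))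
  have count_le : #(B → μ.ord.ToType) ≤ x ^< μ := by
    rw [← power_def, mk_ord_toType]
    exact (power_le_power_right hx).trans (le_powerlt x hb)
  calc (x ^< μ) ^ #B
      ≤ (Cardinal.sum fun i : μ.ord.ToType => x ^ #(Set.Iio i)) ^ #B :=
        power_le_power_right (powerlt_le_sum_mk_Iio x μ)
    _ = Cardinal.sum fun t : B → μ.ord.ToType => Cardinal.prod fun b => x ^ #(Set.Iio (t b)) :=
        (prod_const' B _).symm.trans (prod_sum_eq_sum_prod fun _ i => x ^ #(Set.Iio i))
    _ ≤ Cardinal.sum fun _ : B → μ.ord.ToType => x ^< μ := sum_le_sum _ _ prod_le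
    _ = #(B → μ.ord.ToType) * x ^< μ := sum_const' _ _
    _ ≤ x ^< μ := mul_le_of_le (hμ.aleph0_le.trans (hx.trans hx_le)) count_le le_rfl

namespace IsMuClosed

variable {μ κ l θ : Cardinal.{w}}

theorem succ_powerlt {x : Cardinal.{w}} (hμ : μ.IsRegular) (hx : μ ≤ x) :
    IsMuClosed μ (Order.succ (x ^< μ)) := fun _ hα =>
  Order.lt_succ_of_le <| (powerlt_le_powerlt_right μ (Order.le_of_lt_succ hα)).trans <|
    powerlt_le.2 fun _ hb => power_powerlt_le hμ hx hb

theorem exists_isRegular_isMuClosed (hκ : IsMuClosed μ κ) (hμ : μ.IsRegular) (hl : μ ≤ l)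
    (hlκ : l < κ) (hθ : θ.IsRegular) (hθκ : θ ≤ κ) :
    ∃ ν : Cardinal.{w}, ν.IsRegular ∧ IsMuClosed μ ν ∧ θ ≤ ν ∧ l < ν ∧ ν ≤ κ := by
  by_cases hreg : κ.IsRegular
  · exact ⟨κ, hreg, hκ, hθκ, hlκ, le_rfl⟩
  have hθκ : θ < κ := hθκ.lt_of_ne fun h => hreg (h ▸ hθ)
  have hle : max θ l ≤ max θ l ^< μ :=
    le_powerlt_self _ (one_lt_aleph0.trans_le hμ.aleph0_le)
  have hθ_le : θ ≤ max θ l ^< μ := (le_max_left _ _).trans hle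
  exact ⟨Order.succ (max θ l ^< μ), isRegular_succ (hθ.aleph0_le.trans hθ_le),
    succ_powerlt hμ (hl.trans (le_max_right _ _)), hθ_le.trans (Order.le_succ _),
    Order.lt_succ_of_le ((le_max_right _ _).trans hle),
    Order.succ_le_of_lt (hκ _ (max_lt hθκ hlκ))⟩

end IsMuClosed

namespace IsMuDirected

variable {μ ν : Cardinal.{w}} {I : Type w} [PartialOrder I]

theorem of_le (hI : IsMuDirected ν I) (h : μ ≤ ν) : IsMuDirected μ I :=
  fun s hs => hI s (hs.trans_le h)

theorem isCardinalFiltered [Fact ν.IsRegular] (hI : IsMuDirected ν I) : IsCardinalFiltered I ν :=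
  isCardinalFiltered_preorder I ν fun A s hA => by
    obtain ⟨j, hj⟩ := hI (Set.range s) (mk_range_le.trans_lt hA)
    exact ⟨j, fun k => hj ⟨k, rfl⟩⟩

end IsMuDirected

section Presentability

variable {C : Type u} [Category.{v} C] {X : C} {κ ν : Cardinal.{w}}

theorem IsPresentableAt.of_le {θ : Cardinal.{w}} (hX : IsPresentableAt X θ) (hν : ν.IsRegular)
    (h : θ ≤ ν) : IsPresentableAt X ν := by
  obtain ⟨_, _⟩ := hX
  have : Fact ν.IsRegular := ⟨hν⟩
  exact ⟨this, isCardinalPresentable_of_le X h⟩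

theorem IsPresentableAt.exists_hasPresentabilityRank_le (hX : IsPresentableAt X ν) :
    ∃ θ ≤ ν, HasPresentabilityRank X θ :=
  ⟨sInf {θ | IsPresentableAt X θ}, csInf_le' hX, csInf_mem ⟨ν, hX⟩, fun _ hθ => csInf_le' hθ⟩

theorem IsLTPresentable.exists_isPresentableAt_le (hκ : ℵ₀ ≤ κ)
    (hX : IsLTPresentable X (Order.succ κ)) : ∃ θ ≤ κ, IsPresentableAt X θ := by
  obtain ⟨θ, hθ, hX⟩ := hX
  have haleph : ℵ_ 1 ≤ Order.succ κ := succ_aleph0.symm.le.trans (Order.succ_le_succ hκ)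
  rw [add_eq_left (hκ.trans (Order.le_succ κ)) haleph] at hθ
  exact ⟨θ, Order.le_of_lt_succ hθ, hX⟩

/-- `ν` is a regular cardinal and `X` is a small `ν`-filtered colimit of `ν`-presentable objects.
This is the part of `ν`-accessibility of `C` that concerns the single object `X`. -/
def IsFilteredColimitOfPresentables (X : C) (ν : Cardinal.{w}) : Prop :=
  ∃ (_ : Fact ν.IsRegular) (J : Type w) (_ : SmallCategory J) (_ : IsCardinalFiltered J ν),
    (isCardinalPresentable C ν).colimitsOfShape J X

theorem IsAccessibleAt.isFilteredColimitOfPresentables (hC : IsAccessibleAt C ν) (X : C) :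
    IsFilteredColimitOfPresentables X ν := by
  obtain ⟨hν, hacc⟩ := hC
  obtain ⟨P, _, hP⟩ := hacc.exists_generator
  obtain ⟨J, hJ, hJν, hX⟩ := hP.exists_colimitsOfShape X
  exact ⟨hν, J, hJ, hJν,
    ObjectProperty.colimitsOfShape_monotone J hP.le_isCardinalPresentable X hX⟩

end Presentability

namespace Vocabulary

variable {τ : Vocabulary.{w}}

theorem IsAry.of_le {μ ν : Cardinal.{w}} (hτ : τ.IsAry μ) (h : μ ≤ ν) : τ.IsAry ν :=
  ⟨fun f => (hτ.1 f).trans_le h, fun r => (hτ.2 r).trans_le h⟩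

instance Substr.instPartialOrder (M : τ.Str) : PartialOrder (Substr M) :=
  PartialOrder.lift Substr.carrier fun _ _ => Substr.ext

/-- The inclusion of a substructure. -/
def Substr.incl {M : τ.Str} (S : Substr M) : Emb S.toStr M where
  toFun := Subtype.val
  injective := Subtype.val_injective
  map_fun _ _ := rfl
  map_rel _ _ := Iff.rfl

theorem Substr.range_incl {M : τ.Str} (S : Substr M) : S.incl.range = S :=
  Substr.ext Subtype.range_coe

namespace Emb

variable {M N : τ.Str}

/-- An embedding with values in a substructure `U`, as an embedding into `U`. -/
def codRestrict (f : Emb M N) (U : Substr N) (h : ∀ x, f.toFun x ∈ U.carrier) :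
    Emb M U.toStr where
  toFun x := ⟨f.toFun x, h x⟩
  injective _ _ e := f.injective (congrArg Subtype.val e)
  map_fun s a := Subtype.ext (f.map_fun s a)
  map_rel r a := f.map_rel r a

theorem range_codRestrict (f : Emb M N) (U : Substr N) (h : ∀ x, f.toFun x ∈ U.carrier) :
    (f.codRestrict U h).range = f.range.within U :=
  Substr.ext <| Set.ext fun _ => exists_congr fun _ => Subtype.ext_iff

/-- The inverse of a surjective embedding. -/
noncomputable def symm (f : Emb M N) (hf : Function.Surjective f.toFun) : Emb N M where
  toFun := Function.surjInv hf
  injective := Function.injective_surjInv hf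
  map_fun s a := f.injective (by simp only [f.map_fun, Function.surjInv_eq hf])
  map_rel r a := by simp only [f.map_rel, Function.surjInv_eq hf]

theorem range_symm (f : Emb M N) (hf : Function.Surjective f.toFun) :
    (f.symm hf).range = Substr.whole M :=
  Substr.ext <| Set.eq_univ_of_forall fun x =>
    ⟨f.toFun x, f.injective (Function.surjInv_eq hf (f.toFun x))⟩

end Emb

end Vocabulary

namespace AbstractClass

variable {τ : Vocabulary.{w}} {K : AbstractClass τ}

theorem comp_toFun {M N P : K.Obj} (f : M ⟶ N) (g : N ⟶ P) (x : M.str.carrier) :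
    (f ≫ g).emb.toFun x = g.emb.toFun (f.emb.toFun x) := rfl

theorem hom_ext {M N : K.Obj} {f g : M ⟶ N} (h : ∀ x, f.emb.toFun x = g.emb.toFun x) :
    f = g :=
  Hom.ext (Emb.ext (funext h))

theorem exists_section_of_surjective {M N : K.Obj} (f : M ⟶ N)
    (hf : Function.Surjective f.emb.toFun) : ∃ g : N ⟶ M, g ≫ f = 𝟙 N :=
  ⟨⟨f.emb.symm hf, f.emb.range_symm hf ▸ K.le_refl _ M.mem⟩,
    hom_ext fun x => Function.surjInv_eq hf x⟩

/-- A substructure `S ≤ M`, as an object. -/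
def ofLE {M : τ.Str} {S : Substr M} (h : K.le M S) : K.Obj := ⟨S.toStr, (K.mem_of_le _ _ h).2⟩

/-- The inclusion of `S ≤ M`, as a morphism. -/
def inclHom {M : K.Obj} {S : Substr M.str} (h : K.le M.str S) : ofLE h ⟶ M :=
  ⟨S.incl, S.range_incl.symm ▸ h⟩

variable (K) in
/-- The downward Löwenheim–Skolem property below `θ`: fewer than `θ` elements of a member `M` of
`K` lie in some `S ≤ M` with fewer than `θ` elements. -/
def DownwardLS (θ : Cardinal.{w}) : Prop :=
  ∀ M : τ.Str, K.mem M → ∀ A : Set M.carrier, #A < θ →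
    ∃ S : Substr M, K.le M S ∧ A ⊆ S.carrier ∧ #S.carrier < θ

theorem LST.downwardLS {μ l θ : Cardinal.{w}} (hl : K.LST μ l) (hlθ : l < θ)
    (hθ : IsMuClosed μ θ) (hinf : ℵ₀ ≤ θ) : K.DownwardLS θ := by
  intro M hM A hA
  obtain ⟨S, hS, hAS, hcard⟩ := hl.2.2 M hM A
  exact ⟨S, hS, hAS, hcard.trans_lt (add_lt_of_lt hinf (hθ _ hA) hlθ)⟩

variable (K) in
/-- The axioms of a `ν`-abstract elementary class which concern substructures of one given member:
unions of `ν`-directed systems are only considered inside a member of `K` which is above the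
system, and no Löwenheim–Skolem property is required. -/
structure HasBoundedUnions (ν : Cardinal.{w}) : Prop where
  ary : τ.IsAry ν
  coherence : ∀ (N : τ.Str) (S T : Substr N), S.carrier ⊆ T.carrier →
    K.le N S → K.le N T → K.le T.toStr (S.within T)
  le_union : ∀ (N : τ.Str) (I : Type w) [PartialOrder I] (S : I → Substr N),
    K.IsDirectedSystem ν S → (∀ i, K.le N (S i)) →
      ∀ U : Substr N, (∀ x, x ∈ U.carrier ↔ ∃ i, x ∈ (S i).carrier) → K.le N U

namespace IsMuAEC

variable {μ : Cardinal.{w}}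

theorem hasBoundedUnions (hK : K.IsMuAEC μ) : K.HasBoundedUnions μ :=
  ⟨hK.ary, hK.coherence, hK.chain_le⟩

theorem lst_LS (hK : K.IsMuAEC μ) : K.LST μ (K.LS μ) := csInf_mem (s := {κ | K.LST μ κ}) hK.lst

end IsMuAEC

namespace HasBoundedUnions

variable {ν : Cardinal.{w}}

theorem of_le {μ : Cardinal.{w}} (hK : K.HasBoundedUnions μ) (h : μ ≤ ν) :
    K.HasBoundedUnions ν where
  ary := hK.ary.of_le h
  coherence := hK.coherence
  le_union N I _ S hS := hK.le_union N I S ⟨hS.1.of_le h, hS.2⟩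

/-- A morphism to `N` with values in `U ≤ N`, as a morphism to `U`. -/
def liftHom (hK : K.HasBoundedUnions ν) {M N : K.Obj} (f : M ⟶ N) {U : Substr N.str}
    (hU : K.le N.str U) (h : ∀ x, f.emb.toFun x ∈ U.carrier) : M ⟶ ofLE hU :=
  ⟨f.emb.codRestrict U h, by
    change K.le U.toStr (f.emb.codRestrict U h).range
    rw [Emb.range_codRestrict]
    exact hK.coherence _ _ _ (Set.range_subset_iff.2 h) f.range_le hU⟩

theorem le_of_isMuDirected (hK : K.HasBoundedUnions ν) {N : τ.Str} (F : Set (Substr N))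
    (hF : ∀ S ∈ F, K.le N S) (hdir : IsMuDirected ν F) (U : Substr N)
    (hU : ∀ x, x ∈ U.carrier ↔ ∃ S ∈ F, x ∈ S.carrier) : K.le N U := by
  refine hK.le_union N F Subtype.val
    ⟨hdir, fun S => (K.mem_of_le _ _ (hF _ S.2)).2, fun S T hST => ?_⟩
    (fun S => hF _ S.2) U fun x => by simp only [hU, Subtype.exists, exists_prop]
  exact ⟨hST, hK.coherence _ _ _ hST (hF _ S.2) (hF _ T.2)⟩

end HasBoundedUnions

section FilteredColimits

variable {J : Type w} [SmallCategory J] {D : J ⥤ K.Obj} {c : Cocone D} {ν : Cardinal.{w}}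

/-- Every element of the point of the cocone `c` comes from an object of the diagram. -/
def IsJointlySurjective (c : Cocone D) : Prop :=
  ∀ x : c.pt.str.carrier, ∃ j y, (c.ι.app j).emb.toFun y = x

theorem ι_map_toFun (c : Cocone D) {j k : J} (f : j ⟶ k) (y : (D.obj j).str.carrier) :
    (c.ι.app k).emb.toFun ((D.map f).emb.toFun y) = (c.ι.app j).emb.toFun y := by
  rw [← comp_toFun, c.w]

variable [Fact ν.IsRegular] [IsCardinalFiltered J ν]

theorem exists_forall_mem_range (c : Cocone D) {A : Type w} (hA : #A < ν)
    (x : A → c.pt.str.carrier) (hx : ∀ a, ∃ j y, (c.ι.app j).emb.toFun y = x a) :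
    ∃ j, ∀ a, ∃ y, (c.ι.app j).emb.toFun y = x a := by
  choose j y hy using hx
  have hA' : HasCardinalLT A ν := by rwa [hasCardinalLT_iff_cardinal_mk_lt]
  refine ⟨IsCardinalFiltered.max j hA', fun a =>
    ⟨(D.map (IsCardinalFiltered.toMax j hA' a)).emb.toFun (y a), ?_⟩⟩
  rw [ι_map_toFun, hy]

/-- The union of the images of the objects of a `ν`-filtered diagram in the point of a cocone. -/
def unionRange (hτ : τ.IsAry ν) (c : Cocone D) : Substr c.pt.str where
  carrier := {x | ∃ j y, (c.ι.app j).emb.toFun y = x}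
  closed f a ha := by
    obtain ⟨j, hj⟩ := exists_forall_mem_range c (hτ.1 f) a ha
    choose y hy using hj
    exact ⟨j, (D.obj j).str.funMap f y, by rw [Emb.map_fun]; exact congrArg _ (funext hy)⟩

theorem isMuDirected_range_ι (c : Cocone D) :
    IsMuDirected ν (Set.range fun j => (c.ι.app j).emb.range : Set (Substr c.pt.str)) := by
  intro s hs
  choose j hj using fun S : s => S.1.2
  have hs' : HasCardinalLT s ν := by rwa [hasCardinalLT_iff_cardinal_mk_lt]
  refine ⟨⟨_, IsCardinalFiltered.max j hs', rfl⟩, fun S hS => ?_⟩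
  change S.1.carrier ⊆ _
  rw [← hj ⟨S, hS⟩]
  rintro _ ⟨y, rfl⟩
  exact ⟨(D.map (IsCardinalFiltered.toMax j hs' ⟨S, hS⟩)).emb.toFun y, ι_map_toFun c _ y⟩

theorem HasBoundedUnions.le_unionRange (hK : K.HasBoundedUnions ν) (c : Cocone D) :
    K.le c.pt.str (unionRange hK.ary c) := by
  refine hK.le_of_isMuDirected _ ?_ (isMuDirected_range_ι c) _ fun x => ?_
  · rintro _ ⟨j, rfl⟩
    exact (c.ι.app j).range_le
  · rw [Set.exists_range_iff]
    exact Iff.rfl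

theorem HasBoundedUnions.isJointlySurjective (hK : K.HasBoundedUnions ν) (hc : IsColimit c) :
    IsJointlySurjective c := by
  intro x
  have hU := hK.le_unionRange c
  let s : Cocone D :=
    { pt := ofLE hU
      ι :=
        { app := fun j => hK.liftHom (c.ι.app j) hU fun y => ⟨j, y, rfl⟩
          naturality := fun j k f => hom_ext fun y => Subtype.ext (ι_map_toFun c f y) } }
  have desc_incl : hc.desc s ≫ inclHom hU = 𝟙 c.pt := by
    refine hc.hom_ext fun j => ?_
    rw [← Category.assoc, hc.fac, Category.comp_id]
    exact hom_ext fun y => rfl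
  have hx : ((hc.desc s).emb.toFun x).1 = x :=
    congrArg (fun f : c.pt ⟶ c.pt => f.emb.toFun x) desc_incl
  exact hx ▸ ((hc.desc s).emb.toFun x).2

include ν in
theorem ι_toFun_eq_of_ι_toFun_eq (c s : Cocone D) {j k : J} {y : (D.obj j).str.carrier}
    {z : (D.obj k).str.carrier} (h : (c.ι.app j).emb.toFun y = (c.ι.app k).emb.toFun z) :
    (s.ι.app j).emb.toFun y = (s.ι.app k).emb.toFun z := by
  have := isFiltered_of_isCardinalFiltered J ν
  have hmax : (D.map (IsFiltered.leftToMax j k)).emb.toFun y =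
      (D.map (IsFiltered.rightToMax j k)).emb.toFun z :=
    (c.ι.app (IsFiltered.max j k)).emb.injective (by rw [ι_map_toFun, ι_map_toFun, h])
  rw [← ι_map_toFun s (IsFiltered.leftToMax j k), hmax, ι_map_toFun]

namespace IsJointlySurjective

/-- The map from the point of a jointly surjective cocone to the point of another cocone which is
compatible with both cocones. -/
noncomputable def descFun (hc : IsJointlySurjective c) (s : Cocone D) (x : c.pt.str.carrier) :
    s.pt.str.carrier :=
  (s.ι.app (hc x).choose).emb.toFun (hc x).choose_spec.choose

include ν in
theorem descFun_ι (hc : IsJointlySurjective c) (s : Cocone D) (j : J)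
    (y : (D.obj j).str.carrier) :
    hc.descFun s ((c.ι.app j).emb.toFun y) = (s.ι.app j).emb.toFun y :=
  ι_toFun_eq_of_ι_toFun_eq (ν := ν) c s (hc _).choose_spec.choose_spec

/-- `descFun` as an embedding; it is injective because the legs of `s` are. -/
noncomputable def descEmb (hτ : τ.IsAry ν) (hc : IsJointlySurjective c) (s : Cocone D) :
    Emb c.pt.str s.pt.str where
  toFun := hc.descFun s
  injective x x' h := by
    obtain ⟨j, y, rfl⟩ := hc x
    obtain ⟨k, z, rfl⟩ := hc x'
    rw [descFun_ι (ν := ν), descFun_ι (ν := ν)] at h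
    exact ι_toFun_eq_of_ι_toFun_eq (ν := ν) s c h
  map_fun f a := by
    obtain ⟨j, hj⟩ := exists_forall_mem_range c (hτ.1 f) a fun i => hc (a i)
    choose y hy using hj
    obtain rfl : (fun i => (c.ι.app j).emb.toFun (y i)) = a := funext hy
    simp only [← Emb.map_fun, descFun_ι (ν := ν)]
  map_rel r a := by
    obtain ⟨j, hj⟩ := exists_forall_mem_range c (hτ.2 r) a fun i => hc (a i)
    choose y hy using hj
    obtain rfl : (fun i => (c.ι.app j).emb.toFun (y i)) = a := funext hy
    simp only [← Emb.map_rel, descFun_ι (ν := ν)]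

theorem range_descEmb (hτ : τ.IsAry ν) (hc : IsJointlySurjective c) (s : Cocone D) :
    (hc.descEmb hτ s).range = unionRange hτ s := by
  ext z
  constructor
  · rintro ⟨x, rfl⟩
    exact ⟨_, _, rfl⟩
  · rintro ⟨j, y, rfl⟩
    exact ⟨_, hc.descFun_ι (ν := ν) s j y⟩

theorem nonempty_isColimit (hK : K.HasBoundedUnions ν) (hc : IsJointlySurjective c) :
    Nonempty (IsColimit c) := by
  refine ⟨{
    desc := fun s => ⟨hc.descEmb hK.ary s, hc.range_descEmb hK.ary s ▸ hK.le_unionRange s⟩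
    fac := fun s j => hom_ext (hc.descFun_ι (ν := ν) s j)
    uniq := fun s m hm => hom_ext fun x => ?_ }⟩
  obtain ⟨j, y, rfl⟩ := hc x
  rw [← comp_toFun, hm]
  exact (hc.descFun_ι (ν := ν) s j y).symm

theorem exists_surjective_ι (hc : IsJointlySurjective c) (hν : #c.pt.str.carrier < ν) :
    ∃ j, Function.Surjective (c.ι.app j).emb.toFun :=
  exists_forall_mem_range c hν id hc

theorem exists_le_mk_obj {κ : Cardinal.{w}} (hc : IsJointlySurjective c) (hκν : κ < ν)
    (hκ : κ ≤ #c.pt.str.carrier) : ∃ j, κ ≤ #(D.obj j).str.carrier := by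
  obtain ⟨A, rfl⟩ := le_mk_iff_exists_set.1 hκ
  obtain ⟨j, hj⟩ := exists_forall_mem_range c hκν (fun a : A => a.1) fun a => hc a.1
  choose y hy using hj
  have hinj : Function.Injective y := fun a b h => Subtype.ext (by rw [← hy a, ← hy b, h])
  exact ⟨j, mk_le_of_injective hinj⟩

end IsJointlySurjective

end FilteredColimits

section SmallSub

variable {θ : Cardinal.{w}} {M : K.Obj}

/-- The poset of the substructures `S ≤ M` of size `< θ`. -/
abbrev SmallSub (M : K.Obj) (θ : Cardinal.{w}) : Type w :=
  {S : Substr M.str // K.le M.str S ∧ #S.carrier < θ}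

theorem DownwardLS.exists_smallSub (hLS : K.DownwardLS θ) (A : Set M.str.carrier) (hA : #A < θ) :
    ∃ S : SmallSub M θ, A ⊆ S.1.carrier := by
  obtain ⟨S, hS, hAS, hcard⟩ := hLS M.str M.mem A hA
  exact ⟨⟨S, hS, hcard⟩, hAS⟩

theorem DownwardLS.isMuDirected_smallSub (hLS : K.DownwardLS θ) (hθ : θ.IsRegular) :
    IsMuDirected θ (SmallSub M θ) := by
  intro s hs
  obtain ⟨T, hT⟩ := hLS.exists_smallSub (⋃ S : s, S.1.1.carrier)
    ((card_iUnion_lt_iff_forall_of_isRegular hθ hs).2 fun S => S.1.2.2)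
  exact ⟨T, fun S hS => (Set.subset_iUnion (fun S : s => S.1.1.carrier) ⟨S, hS⟩).trans hT⟩

namespace HasBoundedUnions

/-- The diagram of the substructures `S ≤ M` of size `< θ`. -/
def smallSubFunctor (hK : K.HasBoundedUnions θ) (M : K.Obj) : SmallSub M θ ⥤ K.Obj where
  obj S := ofLE S.2.1
  map {S T} f := hK.liftHom (inclHom S.2.1) T.2.1 fun x => leOfHom f x.2
  map_id _ := hom_ext fun _ => rfl
  map_comp _ _ := hom_ext fun _ => rfl

/-- The cocone of the inclusions of the substructures `S ≤ M` of size `< θ`. -/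
def smallSubCocone (hK : K.HasBoundedUnions θ) (M : K.Obj) : Cocone (hK.smallSubFunctor M) where
  pt := M
  ι :=
    { app := fun S => inclHom S.2.1
      naturality := fun _ _ _ => hom_ext fun _ => rfl }

theorem isJointlySurjective_smallSubCocone (hK : K.HasBoundedUnions θ) (hLS : K.DownwardLS θ)
    (hθ : 1 < θ) : IsJointlySurjective (hK.smallSubCocone M) := by
  intro x
  obtain ⟨S, hS⟩ := hLS.exists_smallSub {x} (by rwa [mk_singleton])
  exact ⟨S, ⟨x, hS rfl⟩, rfl⟩

theorem mk_lt_of_isPresentableAt (hK : K.HasBoundedUnions θ) (hLS : K.DownwardLS θ)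
    (hM : IsPresentableAt M θ) : #M.str.carrier < θ := by
  obtain ⟨hreg, _⟩ := hM
  have := (hLS.isMuDirected_smallSub (M := M) hreg.out).isCardinalFiltered
  obtain ⟨hc⟩ := (hK.isJointlySurjective_smallSubCocone (M := M) hLS
    (one_lt_aleph0.trans_le hreg.out.aleph0_le)).nonempty_isColimit hK
  obtain ⟨S, g, -⟩ := IsCardinalPresentable.exists_hom_of_isColimit θ hc (𝟙 M)
  exact (mk_le_of_injective g.emb.injective).trans_lt S.2.2

theorem mk_lt_of_isPresentableAt_le {μ l κ : Cardinal.{w}} (hK : K.HasBoundedUnions μ)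
    (hμ : μ.IsRegular) (hl : K.LST μ l) (hlκ : l < κ) (hκ : IsMuClosed μ κ) (hθ : θ ≤ κ)
    (hM : IsPresentableAt M θ) : #M.str.carrier < κ := by
  have hμl : μ ≤ l := le_add_self.trans hl.2.1
  obtain ⟨ν, hν, hν_closed, hθν, hlν, hνκ⟩ :=
    hκ.exists_isRegular_isMuClosed hμ hμl hlκ hM.choose.out hθ
  exact ((hK.of_le (hμl.trans hlν.le)).mk_lt_of_isPresentableAt
    (hl.downwardLS hlν hν_closed hν.aleph0_le) (hM.of_le hν hθν)).trans_le hνκ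

end HasBoundedUnions

end SmallSub

namespace HasBoundedUnions

variable {ν κ : Cardinal.{w}}

theorem not_isProper (hK : K.HasBoundedUnions ν) (hν : ν.IsRegular) (hκν : κ < ν) {I : Type w}
    [PartialOrder I] {D : I ⥤ K.Obj} {c : Cocone D} (hI : IsMuDirected ν I) (hc : IsColimit c)
    (hD : ∀ i, #(D.obj i).str.carrier < κ) : ¬ IsProper c := by
  intro hproper
  have : Fact ν.IsRegular := ⟨hν⟩
  have := hI.isCardinalFiltered
  have hsurj := hK.isJointlySurjective hc
  have hpt : #c.pt.str.carrier < κ := by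
    by_contra! hκ
    obtain ⟨i, hi⟩ := hsurj.exists_le_mk_obj hκν hκ
    exact (hD i).not_ge hi
  obtain ⟨i, hi⟩ := hsurj.exists_surjective_ι (hpt.trans hκν)
  exact hproper i (exists_section_of_surjective _ hi)

theorem exists_isPresentableAt_le_mk (hK : K.HasBoundedUnions ν) (hκν : κ < ν) {M : K.Obj}
    (hM : IsFilteredColimitOfPresentables M ν) (hκ : κ ≤ #M.str.carrier) :
    ∃ N : K.Obj, IsPresentableAt N ν ∧ κ ≤ #N.str.carrier := by
  obtain ⟨hν, J, _, _, ⟨p⟩⟩ := hM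
  obtain ⟨j, hj⟩ := (hK.isJointlySurjective p.isColimit).exists_le_mk_obj hκν hκ
  exact ⟨p.diag.obj j, ⟨hν, p.prop_diag_obj j⟩, hj⟩

end HasBoundedUnions

end AbstractClass

theorem mainTheorem11_general {τ : Vocabulary.{w}} {K : AbstractClass τ} {μ l κ ν : Cardinal.{w}}
    (hμ : μ.IsRegular) (hK : K.HasBoundedUnions μ) (hl : K.LST μ l) (hlκ : l < κ)
    (hκ : IsMuClosed μ κ) (hκν : κ < ν) :
    (∀ (I : Type w) [PartialOrder I] (D : I ⥤ K.Obj) (c : Cocone D),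
      IsSystem ν (Order.succ κ) D → Nonempty (IsColimit c) → ¬ IsProper c) ∧
    ∀ M : K.Obj, IsFilteredColimitOfPresentables M ν → κ ≤ #M.str.carrier →
      ∃ (N : K.Obj) (θ : Cardinal.{w}), κ < θ ∧ θ ≤ ν ∧ HasPresentabilityRank N θ := by
  have hμκ : μ ≤ κ := (le_add_self.trans hl.2.1).trans hlκ.le
  have hinf : ℵ₀ ≤ κ := hμ.aleph0_le.trans hμκ
  refine ⟨fun I _ D c ⟨hI, hD⟩ ⟨hc⟩ => ?_, fun M hM hM_le => ?_⟩
  · refine (hK.of_le (hμκ.trans (Order.le_succ κ))).not_isProper (isRegular_succ hinf)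
      (Order.lt_succ κ) (hI.of_le (Order.succ_le_of_lt hκν)) hc fun i => ?_
    obtain ⟨θ, hθ, hDi⟩ := (hD i).exists_isPresentableAt_le hinf
    exact hK.mk_lt_of_isPresentableAt_le hμ hl hlκ hκ hθ hDi
  · obtain ⟨N, hN, hN_le⟩ :=
      (hK.of_le (hμκ.trans hκν.le)).exists_isPresentableAt_le_mk hκν hM hM_le
    obtain ⟨θ, hθν, hrank⟩ := hN.exists_hasPresentabilityRank_le
    refine ⟨N, θ, ?_, hθν, hrank⟩
    by_contra! hθκ
    exact (hK.mk_lt_of_isPresentableAt_le hμ hl hlκ hκ hθκ hrank.1).not_ge hN_le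

theorem mainTheorem11 {τ : Vocabulary.{w}} (K : AbstractClass τ) (μ : Cardinal.{w})
    (hK : K.IsMuAEC μ) (κ : Cardinal.{w}) (hLS : K.LS μ < κ) (hκ : IsMuClosed μ κ) :
    (∀ (I : Type w) [PartialOrder I] (D : I ⥤ K.Obj) (c : Cocone D),
      IsSystem (Order.succ κ) (Order.succ κ) D → Nonempty (IsColimit c) → ¬ IsProper c) ∧
    (IsAccessibleAt K.Obj (Order.succ κ) → (∃ M : K.Obj, κ ≤ #M.str.carrier) →
      ∃ M : K.Obj, HasPresentabilityRank M (Order.succ κ)) := by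
  have h := mainTheorem11_general hK.regular hK.hasBoundedUnions hK.lst_LS hLS hκ (Order.lt_succ κ)
  refine ⟨h.1, fun hacc ⟨M, hM⟩ => ?_⟩
  obtain ⟨N, θ, hκθ, hθκ, hN⟩ := h.2 M (hacc.isFilteredColimitOfPresentables M) hM
  exact ⟨N, hθκ.antisymm (Order.succ_le_of_lt hκθ) ▸ hN⟩
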